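/- **Theorem (Cyclicity theorem).** Work in the max-plus semiring $\mathbb{R}_{\max}=\mathbb{R}\cup\{-\infty\}$, with sum $\oplus=\max$ (supremum, for infinite families), product $ab:=a+b$, zero $-\infty$ and unit $0$, completed by $+\infty$ with $-\infty$ absorbing for the product. Let $S$ be a set and $A\in\mathbb{R}_{\max}^{S\times S}$. Matrix products and powers are max-plus ones, $A^0=I$ being the matrix with $0$ on the diagonal and $-\infty$ elsewhere; $B^*:=\bigoplus_{n\ge 0}B^n$. Let $G(A)$ be the digraph with set of nodes $S$ and an arc $i\to j$ whenever $A_{ij}\ne-\infty$; $A$ is *irreducible* if $G(A)$ has exactly one strongly connected component. The *maximal circuit mean* is $$\rho(A):=\bigoplus_{k\ge1}(\operatorname{tr}A^k)^{1/k}=\sup_{k\ge 1}\sup_{i\in S}\tfrac1k\,(A^k)_{ii},$$ assumed to be a real number, and $\tilde A:=\rho(A)^{-1}A$, that is, $\tilde A_{ij}=A_{ij}-\rho(A)$ in the usual notation. The *critical graph* $G^c(A)$ is the union of the circuits of $G(A)$ whose mean weight (sum of the weights $A_{ij}$ of the arcs divided, in the usual algebra, by the number of arcs) equals $\rho(A)$;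 $N^c(A)$ is its set of nodes, called the critical nodes. The cyclicity $\sigma(A)$ of the critical graph is the lcm, over its strongly connected components, of the gcd of the lengths of the circuits of the component; it is infinite when these gcds have no positive common multiple. A matrix $B$ has *Property (T)* if for all $i,j\in S$ the map $k\mapsto B^*_{ik}B^*_{kj}$ does not take the value $+\infty$ and the set $\{k\in S: B^*_{ik}B^*_{kj}\ge\beta\}$ is finite for every $\beta\in\mathbb{R}$. Assume that $A$ is irreducible, that $\tilde A$ has Property (T), and that $N^c(A)\neq\emptyset$. Then, for all $i,j\in S$, there exist integers $\sigma_{ij}\ge 1$ and $n_{ij}\ge 0$ such that $$A^{n+\sigma_{ij}}_{ij}=\rho(A)^{\sigma_{ij}}A^n_{ij}\qquad\text{for all } n\ge n_{ij}$$ (in the usual notation, $A^{n+\sigma_{ij}}_{ij}=\sigma_{ij}\,\rho(A)+A^n_{ij}$), and $$\tilde A^n_{ij}=\bigoplus_{k\in N^c(A)}\bigl(\tilde A^{q}(\tilde A^{\sigma_{ij}})^*\bigr)_{ik}\,\bigl(\tilde A^{q'}(\tilde A^{\sigma_{ij}})^*\bigr)_{kj}\qquad\text{for all } n\ge n_{ij}$$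 and all $q,q'\in\{0,\dots,\sigma_{ij}-1\}$ with $q+q'\equiv n \pmod{\sigma_{ij}}$. Furthermore, when $\sigma(A)$ is finite, $\sigma_{ij}$ can be chosen so that it divides $\sigma(A)$. -/

import Mathlib

/-!
Max-plus linear algebra over an arbitrary index set `S`.  The completed max-plus semiring is
`EReal`: the semiring sum is the supremum, the semiring product is `+`, the zero is `⊥`, the unit
is `0`.  In `EReal` one has `⊥ + ⊤ = ⊥`, so `⊥` is absorbing for the semiring product.
-/

namespace MaxPlus

noncomputable section

variable {S : Type*}

/-- The max-plus product of two kernels. -/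
def mul (A B : S → S → EReal) : S → S → EReal :=
  fun i j => ⨆ k, A i k + B k j

open Classical in
/-- The max-plus identity kernel. -/
def one : S → S → EReal :=
  fun i j => if i = j then 0 else ⊥

/-- The max-plus powers of a kernel. -/
def pow (A : S → S → EReal) : ℕ → S → S → EReal
  | 0 => one
  | n + 1 => mul (pow A n) A

/-- The Kleene star, the supremum of all powers of the kernel, the power `0` included. -/
def kleeneStar (A : S → S → EReal) : S → S → EReal :=
  fun i j => ⨆ n : ℕ, pow A n i j

/-- The max-plus trace. -/
def trace (A : S → S → EReal) : EReal := ⨆ i, A i i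

/-- The maximal circuit mean: the supremum over `k ≥ 1` of the max-plus `k`-th roots of the traces
of the `k`-th powers (a max-plus `k`-th root is an ordinary division by `k`). -/
def rho (A : S → S → EReal) : EReal :=
  ⨆ k : ℕ, trace (pow A (k + 1)) / ((k + 1 : ℕ) : EReal)

/-- The normalized kernel, the max-plus product of `ρ(A)⁻¹` and `A`. -/
def normalized (A : S → S → EReal) : S → S → EReal :=
  fun i j => A i j - rho A

/-! ### Graphs

An arc relation on `S` is a map `S → S → Prop`.  A path of length `n` is given by its nodes
`p 0, …, p n`; the values of `p` beyond `n` play no role. -/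

/-- The nodes `p 0, …, p n` form a path of length `n`. -/
def IsPath (R : S → S → Prop) (n : ℕ) (p : ℕ → S) : Prop :=
  ∀ m < n, R (p m) (p (m + 1))

/-- The nodes `p 0, …, p n` form a circuit, that is a closed path of nonzero length. -/
def IsCircuit (R : S → S → Prop) (n : ℕ) (p : ℕ → S) : Prop :=
  0 < n ∧ IsPath R n p ∧ p n = p 0

/-- `i` and `j` lie in the same strongly connected component. -/
def SameComponent (R : S → S → Prop) (i j : S) : Prop :=
  Relation.ReflTransGen R i j ∧ Relation.ReflTransGen R j i

/-- The cyclicity of the strongly connected component of `v`: the gcd of the lengths of the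
circuits of this component. -/
def componentCyclicity (R : S → S → Prop) (v : S) : ℕ :=
  Nat.setGcd {n | ∃ p : ℕ → S, IsCircuit R n p ∧ ∀ m ≤ n, SameComponent R v (p m)}

/-- The cyclicity of the graph with set of nodes `N` and arc relation `R`: the lcm of the
cyclicities of its strongly connected components, that is the least positive common multiple of
them, and `⊤` if they have no positive common multiple. -/
def cyclicity (N : Set S) (R : S → S → Prop) : ℕ∞ :=
  ⨅ m ∈ {m : ℕ | 0 < m ∧ ∀ v ∈ N, componentCyclicity R v ∣ m}, (m : ℕ∞)

/-- The arcs of the graph `G(A)`. -/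
def Arc (A : S → S → EReal) (i j : S) : Prop := A i j ≠ ⊥

/-- `A` is irreducible: `G(A)` has exactly one strongly connected component. -/
def IsIrreducible (A : S → S → EReal) : Prop :=
  Nonempty S ∧ ∀ i j, SameComponent (Arc A) i j

/-- The weight of the path `p 0, …, p n`. -/
def weight (A : S → S → EReal) (n : ℕ) (p : ℕ → S) : EReal :=
  ∑ m ∈ Finset.range n, A (p m) (p (m + 1))

/-- A circuit of `G(A)` whose mean weight equals the maximal circuit mean. -/
def IsCriticalCircuit (A : S → S → EReal) (n : ℕ) (p : ℕ → S) : Prop :=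
  IsCircuit (Arc A) n p ∧ weight A n p / (n : EReal) = rho A

/-- The nodes of the critical graph, the union of all critical circuits. -/
def criticalNodes (A : S → S → EReal) : Set S :=
  {i | ∃ (n : ℕ) (p : ℕ → S), IsCriticalCircuit A n p ∧ ∃ m < n, p m = i}

/-- The arcs of the critical graph. -/
def CriticalArc (A : S → S → EReal) (i j : S) : Prop :=
  ∃ (n : ℕ) (p : ℕ → S), IsCriticalCircuit A n p ∧ ∃ m < n, p m = i ∧ p (m + 1) = j

/-- The cyclicity `σ(A)` of the critical graph of `A`. -/
def criticalCyclicity (A : S → S → EReal) : ℕ∞ :=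
  cyclicity (criticalNodes A) (CriticalArc A)

/-! ### Tightness -/

/-- `v` does not take the value `+∞` and has finite super-level sets. -/
def Tight (v : S → EReal) : Prop :=
  (∀ j, v j ≠ ⊤) ∧ ∀ β : ℝ, {j | (β : EReal) ≤ v j}.Finite

/-- `u` is `A`-tight. -/
def TightFor (A : S → S → EReal) (u : S → EReal) : Prop :=
  ∀ i, Tight fun j => A i j + u j

/-- Property (T): all the columns of the Kleene star of `A` are tight for it. -/
def PropertyT (A : S → S → EReal) : Prop :=
  ∀ j, TightFor (kleeneStar A) fun k => kleeneStar A k j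

end

end MaxPlus

namespace MaxPlus

open scoped Pointwise

variable {S : Type*}

/-! ### Suprema of sets of reals in the completed max-plus semiring -/

/-! After subtracting `ρ(A)` from every arc, closed paths have weight at most zero and critical
circuits are those of weight zero. The `(i, j)` entry of the `n`-th power is the supremum of the
weights of the paths of length `n` from `i` to `j`, so everything becomes a comparison of sets of
path weights.

Fix a critical node `k₀`. Inserting zero-weight loops at `k₀` shows that some real `β` bounds from
below a path of each large length `n`, provided any path exists with length in the class of `n`
modulo the period of `k₀` (`exists_lower_bound`). Lighter paths can thus be ignored, and Property
(T) confines the paths of weight at least `β` to a finite set of nodes.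

Such a path, if long, visits a critical node: the remaining nodes span a finite graph with negative
circuits, where weights fall linearly (`exists_forall_visits`). Conversely, if a heavy path visits a
critical node and only its length modulo `σ` is right, both halves can be shortened modulo `σ`, then
zero-weight loops restore the exact length (`exists_forall_dominates`). Here `σ` is the lcm of the
periods of `k₀` and of the finitely many critical nodes on heavy paths. So the supremum ultimately
depends only on `n` modulo `σ`. Sliding the visited node along its zero-weight circuit gives the
factorization. -/

/-- The supremum in `EReal` of a set of reals. -/
noncomputable def realSup (X : Set ℝ) : EReal := sSup (Real.toEReal '' X)

theorem le_realSup {X : Set ℝ} {x : ℝ} (hx : x ∈ X) : (x : EReal) ≤ realSup X :=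
  le_sSup ⟨x, hx, rfl⟩

theorem realSup_le_iff {X : Set ℝ} {c : EReal} : realSup X ≤ c ↔ ∀ x ∈ X, (x : EReal) ≤ c := by
  simp [realSup, sSup_le_iff]

theorem lt_realSup_iff {X : Set ℝ} {c : EReal} : c < realSup X ↔ ∃ x ∈ X, c < (x : EReal) := by
  simp [realSup, lt_sSup_iff]

@[simp]
theorem realSup_empty : realSup ∅ = ⊥ := by simp [realSup]

@[simp]
theorem realSup_singleton (x : ℝ) : realSup {x} = x := by simp [realSup]

theorem realSup_iUnion {ι : Sort*} (X : ι → Set ℝ) : realSup (⋃ i, X i) = ⨆ i, realSup (X i) := by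
  apply le_antisymm
  · rw [realSup_le_iff]
    intro x hx
    obtain ⟨i, hi⟩ := Set.mem_iUnion.1 hx
    exact (le_realSup hi).trans (le_iSup (fun i => realSup (X i)) i)
  · refine iSup_le fun i => realSup_le_iff.2 fun x hx => le_realSup (Set.mem_iUnion.2 ⟨i, hx⟩)

/-- No boundedness or nonemptiness is needed because `⊥ + ⊤ = ⊥`: an empty summand gives an empty
sum set. This turns max-plus products into concatenations of paths. -/
theorem realSup_add (X Y : Set ℝ) : realSup (X + Y) = realSup X + realSup Y := by
  apply le_antisymm
  · rw [realSup_le_iff]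
    rintro _ ⟨x, hx, y, hy, rfl⟩
    rw [EReal.coe_add]
    exact add_le_add (le_realSup hx) (le_realSup hy)
  · refine EReal.add_le_of_forall_lt fun a ha b hb => ?_
    obtain ⟨x, hx, hax⟩ := lt_realSup_iff.1 ha
    obtain ⟨y, hy, hby⟩ := lt_realSup_iff.1 hb
    refine (add_le_add hax.le hby.le).trans ?_
    rw [← EReal.coe_add]
    exact le_realSup (Set.add_mem_add hx hy)

theorem realSup_le_of_forall_exists {X Y : Set ℝ} (h : ∀ x ∈ X, ∃ y ∈ Y, x ≤ y) :
    realSup X ≤ realSup Y := by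
  rw [realSup_le_iff]
  intro x hx
  obtain ⟨y, hy, hxy⟩ := h x hx
  exact (EReal.coe_le_coe_iff.2 hxy).trans (le_realSup hy)

/-! ### Weights of paths -/

/-- The set of the weights of the paths of length `n` from `i` to `j` in the graph with arc
relation `R`, the arc `(x, y)` having the weight `a x y`. -/
def pathWeights (R : S → S → Prop) (a : S → S → ℝ) (n : ℕ) (i j : S) : Set ℝ :=
  {w | ∃ p : ℕ → S, p 0 = i ∧ p n = j ∧ IsPath R n p ∧
    ∑ m ∈ Finset.range n, a (p m) (p (m + 1)) = w}

section

variable {R : S → S → Prop} {a : S → S → ℝ}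

theorem sum_mem_pathWeights {n : ℕ} {p : ℕ → S} (hp : IsPath R n p) {s d : ℕ} (h : s + d ≤ n) :
    ∑ m ∈ Finset.range d, a (p (s + m)) (p (s + m + 1)) ∈
      pathWeights R a d (p s) (p (s + d)) :=
  ⟨fun m => p (s + m), rfl, rfl, fun m hm => hp (s + m) (by omega), rfl⟩

theorem pathWeights_zero_self (i : S) : (0 : ℝ) ∈ pathWeights R a 0 i i :=
  ⟨fun _ => i, rfl, rfl, fun m hm => by omega, by simp⟩

theorem mem_pathWeights_zero {i j : S} {w : ℝ} : w ∈ pathWeights R a 0 i j ↔ i = j ∧ w = 0 := by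
  constructor
  · rintro ⟨p, rfl, rfl, -, rfl⟩
    simp
  · rintro ⟨rfl, rfl⟩
    exact pathWeights_zero_self i

theorem mem_pathWeights_one {i j : S} {w : ℝ} :
    w ∈ pathWeights R a 1 i j ↔ R i j ∧ w = a i j := by
  constructor
  · rintro ⟨p, rfl, rfl, hp, rfl⟩
    exact ⟨hp 0 one_pos, by simp⟩
  · rintro ⟨hR, rfl⟩
    refine ⟨fun m => if m = 0 then i else j, rfl, rfl, ?_, by simp⟩
    intro m hm
    obtain rfl : m = 0 := by omega
    simpa using hR

theorem pathWeights_concat {m n : ℕ} {i k j : S} {u v : ℝ} (hu : u ∈ pathWeights R a m i k)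
    (hv : v ∈ pathWeights R a n k j) : u + v ∈ pathWeights R a (m + n) i j := by
  obtain ⟨p, rfl, rfl, hp, rfl⟩ := hu
  obtain ⟨q, hq0, rfl, hq, rfl⟩ := hv
  have hle : ∀ x ≤ m, (if x ≤ m then p x else q (x - m)) = p x := fun x hx => if_pos hx
  -- At the junction `x = 0` the value is read off `p`, and agrees with `q 0`.
  have hge : ∀ x, (if m + x ≤ m then p (m + x) else q (m + x - m)) = q x := by
    intro x
    split_ifs with h
    · obtain rfl : x = 0 := by omega
      simp [hq0]
    · simp
  refine ⟨fun x => if x ≤ m then p x else q (x - m), hle 0 (by omega), hge n, ?_, ?_⟩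
  · intro x hx
    rcases lt_or_ge x m with h | h
    · simp only [hle x h.le, hle (x + 1) h]
      exact hp x h
    · obtain ⟨y, rfl⟩ := Nat.exists_eq_add_of_le h
      simp only [add_assoc, hge]
      exact hq y (by omega)
  · rw [Finset.sum_range_add]
    congr 1
    · refine Finset.sum_congr rfl fun x hx => ?_
      have hx := Finset.mem_range.1 hx
      simp only [hle x hx.le, hle (x + 1) hx]
    · refine Finset.sum_congr rfl fun x _ => ?_
      simp only [add_assoc, hge]

theorem mem_pathWeights_add {m n : ℕ} {i j : S} {w : ℝ} :
    w ∈ pathWeights R a (m + n) i j ↔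
      ∃ k, ∃ u ∈ pathWeights R a m i k, ∃ v ∈ pathWeights R a n k j, u + v = w := by
  constructor
  · rintro ⟨p, rfl, rfl, hp, rfl⟩
    exact ⟨p m, _, ⟨p, rfl, rfl, fun x hx => hp x (by omega), rfl⟩, _,
      sum_mem_pathWeights hp le_rfl,
      (Finset.sum_range_add (fun x => a (p x) (p (x + 1))) m n).symm⟩
  · rintro ⟨k, u, hu, v, hv, rfl⟩
    exact pathWeights_concat hu hv

theorem pathWeights_add (m n : ℕ) (i j : S) :
    pathWeights R a (m + n) i j = ⋃ k, pathWeights R a m i k + pathWeights R a n k j := by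
  ext w
  simp only [mem_pathWeights_add, Set.mem_iUnion, Set.mem_add]

theorem pathWeights_nsmul {n : ℕ} {i : S} {w : ℝ} (hw : w ∈ pathWeights R a n i i) (t : ℕ) :
    t * w ∈ pathWeights R a (t * n) i i := by
  induction t with
  | zero => simpa using pathWeights_zero_self i
  | succ t ih =>
    have := pathWeights_concat ih hw
    rw [Nat.succ_mul]
    convert this using 1
    push_cast
    ring

theorem pathWeights_nsmul_zero {n : ℕ} {i : S} (hw : (0 : ℝ) ∈ pathWeights R a n i i) (t : ℕ) :
    (0 : ℝ) ∈ pathWeights R a (t * n) i i := by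
  simpa using pathWeights_nsmul hw t

theorem exists_pathWeights_of_reflTransGen {i j : S} (h : Relation.ReflTransGen R i j) :
    ∃ n, (pathWeights R a n i j).Nonempty := by
  induction h with
  | refl => exact ⟨0, 0, pathWeights_zero_self i⟩
  | tail _ hR ih =>
    obtain ⟨n, w, hw⟩ := ih
    exact ⟨n + 1, _, pathWeights_concat hw (mem_pathWeights_one.2 ⟨hR, rfl⟩)⟩

/-! ### Removing closed subpaths -/

/-- A closed subpath splits a path. -/
theorem exists_split_of_eq {n : ℕ} {p : ℕ → S} (hp : IsPath R n p) {s t : ℕ} (hst : s < t)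
    (ht : t ≤ n) (h : p s = p t) :
    ∃ u ∈ pathWeights R a s (p 0) (p s), ∃ c ∈ pathWeights R a (t - s) (p s) (p s),
      ∃ v ∈ pathWeights R a (n - t) (p s) (p n),
        ∑ m ∈ Finset.range n, a (p m) (p (m + 1)) = u + c + v := by
  have h1 : ∑ m ∈ Finset.range s, a (p (0 + m)) (p (0 + m + 1)) ∈
      pathWeights R a s (p 0) (p (0 + s)) := sum_mem_pathWeights hp (by omega)
  have h2 : ∑ m ∈ Finset.range (t - s), a (p (s + m)) (p (s + m + 1)) ∈
      pathWeights R a (t - s) (p s) (p (s + (t - s))) := sum_mem_pathWeights hp (by omega)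
  have h3 : ∑ m ∈ Finset.range (n - t), a (p (t + m)) (p (t + m + 1)) ∈
      pathWeights R a (n - t) (p t) (p (t + (n - t))) := sum_mem_pathWeights hp (by omega)
  rw [show s + (t - s) = t by omega, ← h] at h2
  rw [show t + (n - t) = n by omega, ← h] at h3
  simp only [zero_add] at h1
  refine ⟨_, h1, _, h2, _, h3, ?_⟩
  rw [← Finset.sum_range_add (fun m => a (p m) (p (m + 1))), show s + (t - s) = t by omega,
    ← Finset.sum_range_add (fun m => a (p m) (p (m + 1))), show t + (n - t) = n by omega]

/-- If all closed paths have nonpositive weight, a path all of whose equivalents visit only the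
finite set `F` may be shortened, modulo `σ`, without decreasing its weight. -/
theorem exists_short_path (hclosed : ∀ n x, ∀ c ∈ pathWeights R a n x x, c ≤ 0)
    {σ : ℕ} (hσ : 0 < σ) (F : Finset S) {i k : S} (n : ℕ) :
    ∀ u ∈ pathWeights R a n i k,
    (∀ x s t, ∀ u₁ ∈ pathWeights R a s i x, ∀ u₂ ∈ pathWeights R a t x k, u ≤ u₁ + u₂ → x ∈ F) →
    ∃ l ≤ F.card * σ, l ≡ n [MOD σ] ∧ ∃ v ∈ pathWeights R a l i k, u ≤ v := by
  induction n using Nat.strong_induction_on with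
  | _ n ih =>
  intro u hu hF
  rcases le_or_gt n (F.card * σ) with hn | hn
  · exact ⟨n, hn, rfl, u, hu, le_rfl⟩
  obtain ⟨p, rfl, rfl, hp, rfl⟩ := hu
  have hmem : ∀ m ≤ n, p m ∈ F := by
    intro m hm
    obtain ⟨d, rfl⟩ := Nat.exists_eq_add_of_le hm
    refine hF (p m) m d _ ⟨p, rfl, rfl, fun x hx => hp x (by omega), rfl⟩ _
      (sum_mem_pathWeights hp le_rfl) ?_
    rw [Finset.sum_range_add]
  -- Pigeonhole on pairs (node, position modulo `σ`): a repetition bounds a closed subpath whose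
  -- length is a multiple of `σ`.
  obtain ⟨s, hs, t, ht, hne, heq⟩ := Finset.exists_ne_map_eq_of_card_lt_of_maps_to
    (s := Finset.range (F.card * σ + 1)) (t := F ×ˢ Finset.range σ)
    (f := fun m => (p m, m % σ)) (by simp) (by
      intro m hm
      simp only [Finset.coe_range, Set.mem_Iio] at hm
      simp only [Finset.coe_product, Set.mem_prod, Finset.mem_coe, Finset.mem_range]
      exact ⟨hmem m (by omega), Nat.mod_lt _ hσ⟩)
  simp only [Finset.mem_range, Prod.mk.injEq] at hs ht heq
  wlog hst : s < t generalizing s t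
  · exact this t s hne.symm ht hs ⟨heq.1.symm, heq.2.symm⟩ (by omega)
  obtain ⟨u₁, hu₁, c, hc, u₂, hu₂, hsum⟩ := exists_split_of_eq (a := a) hp hst (by omega) heq.1
  have hc0 := hclosed _ _ _ hc
  obtain ⟨l, hl, hmod, v, hv, hle⟩ := ih (s + (n - t)) (by omega) _ (pathWeights_concat hu₁ hu₂)
    (fun x s' t' w₁ h₁ w₂ h₂ hw => hF x s' t' w₁ h₁ w₂ h₂ (by linarith))
  refine ⟨l, hl, hmod.trans ?_, v, hv, by linarith⟩
  have : n = s + (n - t) + (t - s) := by omega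
  conv_rhs => rw [this]
  have hd : σ ∣ t - s := (Nat.modEq_iff_dvd' hst.le).1 heq.2
  exact ((Nat.modEq_zero_iff_dvd.2 hd).symm.add_left (s + (n - t)))

theorem finite_pathWeights {G : Set S} (hG : G.Finite) (hR : ∀ x y, R x y → x ∈ G) (n : ℕ)
    (i j : S) : (pathWeights R a n i j).Finite := by
  induction n generalizing i j with
  | zero => exact (Set.finite_singleton (0 : ℝ)).subset fun w hw => (mem_pathWeights_zero.1 hw).2
  | succ n ih =>
    refine (hG.biUnion fun k _ => (ih i k).add (Set.finite_singleton (a k j))).subset ?_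
    intro w hw
    obtain ⟨k, u, hu, v, hv, rfl⟩ := mem_pathWeights_add.1 hw
    obtain ⟨hkj, rfl⟩ := mem_pathWeights_one.1 hv
    exact Set.mem_biUnion (hR _ _ hkj) (Set.add_mem_add hu rfl)

/-- In a finite graph whose circuits have negative weights, the weights of the paths decrease
at a linear rate. -/
theorem exists_linear_bound {G : Set S} (hG : G.Finite) (hR : ∀ x y, R x y → x ∈ G ∧ y ∈ G)
    (hneg : ∀ n x, 0 < n → ∀ c ∈ pathWeights R a n x x, c < 0) (i j : S) :
    ∃ M δ : ℝ, 0 < δ ∧ ∀ n, ∀ w ∈ pathWeights R a n i j, w ≤ M - δ * n := by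
  classical
  set f := hG.toFinset.card + 1 with hf
  have hfin : ∀ n i j, (pathWeights R a n i j).Finite :=
    finite_pathWeights hG fun x y h => (hR x y h).1
  -- Closed paths of length at most `f` have finitely many weights, all negative, hence a uniform
  -- gap `ε`.
  obtain ⟨ε, hε, hεc⟩ : ∃ ε : ℝ, 0 < ε ∧ ∀ x ∈ G, ∀ n, 0 < n → n ≤ f →
      ∀ c ∈ pathWeights R a n x x, c ≤ -ε := by
    have hX : (⋃ x ∈ G, ⋃ n ∈ Set.Icc 1 f, pathWeights R a n x x).Finite :=
      hG.biUnion fun x _ => (Set.finite_Icc 1 f).biUnion fun n _ => hfin n x x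
    obtain ⟨b, hb0, hb⟩ : ∃ b < (0 : ℝ), ∀ c ∈ ⋃ x ∈ G, ⋃ n ∈ Set.Icc 1 f,
        pathWeights R a n x x, c ≤ b := by
      rcases Set.eq_empty_or_nonempty (⋃ x ∈ G, ⋃ n ∈ Set.Icc 1 f, pathWeights R a n x x) with h | h
      · exact ⟨-1, by norm_num, fun c hc => by rw [h] at hc; exact hc.elim⟩
      · obtain ⟨b, hb, hmax⟩ := hX.exists_maximal h
        refine ⟨b, ?_, fun c hc => (le_total c b).elim id (hmax hc)⟩
        simp only [Set.mem_iUnion] at hb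
        obtain ⟨x, -, n, hn, hb⟩ := hb
        exact hneg n x hn.1 b hb
    refine ⟨-b, by linarith, fun x hx n h0 hn c hc => ?_⟩
    rw [neg_neg]
    exact hb c (Set.mem_biUnion hx (Set.mem_biUnion (show n ∈ Set.Icc 1 f from ⟨h0, hn⟩) hc))
  obtain ⟨M, hM⟩ : ∃ M : ℝ, ∀ n ≤ f, ∀ w ∈ pathWeights R a n i j, w ≤ M := by
    obtain ⟨M, hM⟩ := ((Set.finite_Iic f).biUnion fun n _ => hfin n i j).bddAbove
    exact ⟨M, fun n hn w hw => hM (Set.mem_biUnion (show n ∈ Set.Iic f from hn) hw)⟩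
  have hf0 : (0 : ℝ) < f := by rw [hf]; positivity
  -- Each removed closed subpath costs at least `ε` and shortens by at most `f`, whence the slope `ε
  -- / f`; the extra `ε` absorbs the lengths up to `f`.
  refine ⟨M + ε, ε / f, by positivity, fun n => ?_⟩
  induction n using Nat.strong_induction_on with
  | _ n ih =>
  intro w hw
  rcases le_or_gt n f with hn | hn
  · have h1 := hM n hn w hw
    have h2 : ε / f * n ≤ ε := by
      rw [div_mul_eq_mul_div, div_le_iff₀ hf0]
      exact mul_le_mul_of_nonneg_left (by exact_mod_cast hn) hε.le
    linarith
  obtain ⟨p, rfl, rfl, hp, rfl⟩ := hw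
  obtain ⟨s, hs, t, ht, hne, heq⟩ := Finset.exists_ne_map_eq_of_card_lt_of_maps_to
    (s := Finset.range f) (t := hG.toFinset) (f := p) (by simp [hf]) (by
      intro m hm
      simp only [Finset.coe_range, Set.mem_Iio] at hm
      simpa using (hR _ _ (hp m (by omega))).1)
  simp only [Finset.mem_range] at hs ht
  wlog hst : s < t generalizing s t
  · exact this t s hne.symm heq.symm ht hs (by omega)
  obtain ⟨u₁, hu₁, c, hc, u₂, hu₂, hsum⟩ := exists_split_of_eq (a := a) hp hst (by omega) heq
  have hc' := hεc (p s) (hR _ _ (hp s (by omega))).1 _ (by omega) (by omega) c hc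
  have hrec := ih (s + (n - t)) (by omega) _ (pathWeights_concat hu₁ hu₂)
  have hlen : (n : ℝ) ≤ ((s + (n - t) : ℕ) : ℝ) + f := by
    exact_mod_cast (show n ≤ s + (n - t) + f by omega)
  have : ε / f * n ≤ ε / f * ((s + (n - t) : ℕ) : ℝ) + ε := by
    calc ε / f * n ≤ ε / f * (((s + (n - t) : ℕ) : ℝ) + f) := by gcongr
      _ = _ := by field_simp
  linarith

end

/-! ### Zero-weight circuits and ultimate periodicity -/

/-- The nodes of the circuits of zero weight. -/
def zeroNodes (R : S → S → Prop) (a : S → S → ℝ) : Set S :=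
  {x | ∃ n, 0 < n ∧ (0 : ℝ) ∈ pathWeights R a n x x}

/-- The gcd of the lengths of the zero-weight closed paths through `x`. -/
noncomputable def zeroPeriod (R : S → S → Prop) (a : S → S → ℝ) (x : S) : ℕ :=
  Nat.setGcd {n | (0 : ℝ) ∈ pathWeights R a n x x}

/-- The set of the weights of the paths from `i` to `j` that visit a node of a zero-weight circuit
and have a length congruent to `n` modulo `σ`. -/
def zeroNodesWeights (R : S → S → Prop) (a : S → S → ℝ) (σ n : ℕ) (i j : S) : Set ℝ :=
  {w | ∃ k ∈ zeroNodes R a, ∃ l₁ l₂, l₁ + l₂ ≡ n [MOD σ] ∧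
    ∃ u ∈ pathWeights R a l₁ i k, ∃ v ∈ pathWeights R a l₂ k j, u + v = w}

section

variable {R : S → S → Prop} {a : S → S → ℝ}

theorem zeroPeriod_pos {x : S} (hx : x ∈ zeroNodes R a) : 0 < zeroPeriod R a x := by
  obtain ⟨n, hn, h⟩ := hx
  exact Nat.pos_of_dvd_of_pos (Nat.setGcd_dvd_of_mem h) hn

/-- All large multiples of the period of `x` are lengths of zero-weight closed paths. -/
theorem exists_zero_mem_pathWeights_of_ge (R : S → S → Prop) (a : S → S → ℝ) (x : S) :
    ∃ N, ∀ n ≥ N, zeroPeriod R a x ∣ n → (0 : ℝ) ∈ pathWeights R a n x x := by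
  -- Large multiples of a gcd lie in the additive closure; here the set of lengths is already closed
  -- under addition.
  obtain ⟨N, hN⟩ := Nat.exists_mem_closure_of_ge {n | (0 : ℝ) ∈ pathWeights R a n x x}
  refine ⟨N, fun n hn hd => ?_⟩
  refine AddSubmonoid.closure_induction (motive := fun n _ => (0 : ℝ) ∈ pathWeights R a n x x)
    (fun n h => h) (pathWeights_zero_self x) (fun m n _ _ hm hn => ?_) (hN n hn hd)
  simpa using pathWeights_concat hm hn

/-- One may follow a zero-weight circuit for any number of steps. -/
theorem exists_zeroNodes_path {k : S} (hk : k ∈ zeroNodes R a) (t : ℕ) :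
    ∃ k' ∈ zeroNodes R a, ∃ d, ∃ x ∈ pathWeights R a t k k', -x ∈ pathWeights R a d k' k := by
  induction t with
  | zero => exact ⟨k, hk, 0, 0, pathWeights_zero_self k, by simpa using pathWeights_zero_self k⟩
  | succ t ih =>
    obtain ⟨k', ⟨n, hn, hk'⟩, d, x, hx, hx'⟩ := ih
    obtain ⟨m, rfl⟩ := Nat.exists_eq_add_of_le hn
    -- Take the first arc of a zero-weight closed path at `k'`; the rest of that path returns with
    -- the opposite weight.
    obtain ⟨y, u, hu, v, hv, huv⟩ := mem_pathWeights_add.1 hk'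
    obtain rfl : v = -u := by linarith
    have hy : y ∈ zeroNodes R a := by
      refine ⟨m + 1, by omega, ?_⟩
      simpa using pathWeights_concat hv hu
    refine ⟨y, hy, m + d, x + u, pathWeights_concat hx hu, ?_⟩
    rw [show -(x + u) = -u + -x by ring]
    exact pathWeights_concat hv hx'

/-- The return path along a zero-weight circuit may be chosen so that the total length is a
multiple of `σ`. -/
theorem exists_zeroNodes_path_dvd {k : S} (hk : k ∈ zeroNodes R a) {σ : ℕ} (hσ : 0 < σ) (t : ℕ) :
    ∃ k' ∈ zeroNodes R a, ∃ d, σ ∣ t + d ∧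
      ∃ x ∈ pathWeights R a t k k', -x ∈ pathWeights R a d k' k := by
  obtain ⟨k', hk', d, x, hx, hx'⟩ := exists_zeroNodes_path hk t
  have hloop : (0 : ℝ) ∈ pathWeights R a (t + d) k k := by
    simpa using pathWeights_concat hx hx'
  -- With `τ = σ - 1` extra turns, the total length is `σ * (t + d)`.
  obtain ⟨τ, rfl⟩ := Nat.exists_eq_add_of_le hσ
  refine ⟨k', hk', d + τ * (t + d), ⟨t + d, by ring⟩, x, hx, ?_⟩
  simpa using pathWeights_concat hx' (pathWeights_nsmul_zero hloop τ)

/-- The residues modulo `σ` of the lengths of the paths before and after the visited node may be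
prescribed. -/
theorem zeroNodesWeights_eq {σ n q q' : ℕ} (hσ : 0 < σ) (hq' : q' < σ)
    (h : q + q' ≡ n [MOD σ]) (i j : S) :
    zeroNodesWeights R a σ n i j = ⋃ k ∈ zeroNodes R a,
      (⋃ t : ℕ, pathWeights R a (q + σ * t) i k) + ⋃ t : ℕ, pathWeights R a (q' + σ * t) k j := by
  ext w
  simp only [Set.mem_iUnion, Set.mem_add, exists_prop]
  constructor
  · rintro ⟨k, hk, l₁, l₂, hl, u, hu, v, hv, rfl⟩
    -- The number of steps is a natural representative of `q - l₁` modulo `σ`, so the first half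
    -- gets residue `q`.
    obtain ⟨k', hk', d, hd, x, hx, hx'⟩ := exists_zeroNodes_path_dvd hk hσ (q + (σ - 1) * l₁)
    have hlen : l₁ + (q + (σ - 1) * l₁) = q + σ * l₁ := by
      obtain ⟨τ, rfl⟩ := Nat.exists_eq_add_of_le hσ
      rw [Nat.add_sub_cancel_left]
      ring
    have hmod : d + l₂ ≡ q' [MOD σ] := by
      have h1 : q + σ * l₁ + (d + l₂) ≡ q + σ * l₁ + q' [MOD σ] := by
        have e1 : q + σ * l₁ + (d + l₂) = (q + (σ - 1) * l₁ + d) + (l₁ + l₂) := by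
          rw [← hlen]
          ring
        have e2 : q + σ * l₁ + q' = σ * l₁ + (q + q') := by ring
        rw [e1, e2]
        exact ((Nat.modEq_zero_iff_dvd.2 hd).trans
          (Nat.modEq_zero_iff_dvd.2 (dvd_mul_right _ _)).symm).add (hl.trans h.symm)
      exact Nat.ModEq.add_left_cancel' _ h1
    -- As `q' < σ`, it is the remainder of `d + l₂`, so the quotient serves as `t`.
    have hdl : d + l₂ = q' + σ * ((d + l₂) / σ) := by
      have h1 := Nat.mod_add_div (d + l₂) σ
      rw [hmod, Nat.mod_eq_of_lt hq'] at h1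
      exact h1.symm
    refine ⟨k', hk', u + x, ⟨l₁, ?_⟩, -x + v, ⟨(d + l₂) / σ, ?_⟩, by ring⟩
    · rw [← hlen]
      exact pathWeights_concat hu hx
    · rw [← hdl]
      exact pathWeights_concat hx' hv
  · rintro ⟨k, hk, u, ⟨s, hu⟩, v, ⟨t, hv⟩, rfl⟩
    refine ⟨k, hk, _, _, ?_, u, hu, v, hv, rfl⟩
    rw [show q + σ * s + (q' + σ * t) = q + q' + σ * (s + t) by ring]
    simpa using h

/-- If all nodes communicate, the lengths of the paths from `i` to `j` have, in each congruence
class modulo the period of a node `k` of a zero-weight circuit, paths of bounded below weights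
through `k`. -/
theorem exists_lower_bound (hconn : ∀ x y, Relation.ReflTransGen R x y) {k : S}
    (hk : k ∈ zeroNodes R a) (i j : S) :
    ∃ (β : ℝ) (N : ℕ), ∀ n ≥ N, ∀ m, m ≡ n [MOD zeroPeriod R a k] →
      (pathWeights R a m i j).Nonempty → ∃ l₁ l₂, l₁ + l₂ = n ∧
        ∃ u ∈ pathWeights R a l₁ i k, ∃ v ∈ pathWeights R a l₂ k j, β ≤ u + v := by
  set c := zeroPeriod R a k
  have hc : 0 < c := zeroPeriod_pos hk
  obtain ⟨N, hN⟩ := exists_zero_mem_pathWeights_of_ge R a k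
  obtain ⟨d₁, x₁, hx₁⟩ := exists_pathWeights_of_reflTransGen (a := a) (hconn j k)
  obtain ⟨d₂, x₂, hx₂⟩ := exists_pathWeights_of_reflTransGen (a := a) (hconn k j)
  have key : ∀ r, ∃ (β : ℝ) (M : ℕ), ∀ n ≥ M, ∀ m, n ≡ r [MOD c] → m ≡ r [MOD c] →
      (pathWeights R a m i j).Nonempty → ∃ l₁ l₂, l₁ + l₂ = n ∧
        ∃ u ∈ pathWeights R a l₁ i k, ∃ v ∈ pathWeights R a l₂ k j, β ≤ u + v := by
    intro r
    by_cases h : ∃ m, m ≡ r [MOD c] ∧ (pathWeights R a m i j).Nonempty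
    · obtain ⟨m₀, hm₀, w, hw⟩ := h
      -- Go from `i` to `j`, then make `c = τ + 1` turns of `j → k → j`, which preserves the
      -- residue; the zero-weight loops go into the last visit of `k`.
      obtain ⟨τ, hτ⟩ := Nat.exists_eq_add_of_le hc
      have hloop := pathWeights_nsmul (pathWeights_concat hx₁ hx₂) τ
      have h₁ := pathWeights_concat (pathWeights_concat hw hloop) hx₁
      refine ⟨w + τ * (x₁ + x₂) + x₁ + (0 + x₂), m₀ + τ * (d₁ + d₂) + d₁ + d₂ + N, fun n hn m hnr _ _ => ?_⟩
      set L := m₀ + τ * (d₁ + d₂) + d₁ with hL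
      have hdvd : c ∣ n - (L + d₂) := by
        refine (Nat.modEq_iff_dvd' (by omega)).1 ?_
        have e : L + d₂ = m₀ + c * (d₁ + d₂) := by rw [hL, hτ]; ring
        rw [e]
        have : m₀ + c * (d₁ + d₂) ≡ m₀ [MOD c] := by simp [Nat.ModEq]
        exact this.trans (hm₀.trans hnr.symm)
      have h0 := hN (n - (L + d₂)) (by omega) hdvd
      exact ⟨L, n - (L + d₂) + d₂, by omega, _, h₁, _, pathWeights_concat h0 hx₂, le_rfl⟩
    · exact ⟨0, 0, fun n _ m _ hm hne => (h ⟨m, hm, hne⟩).elim⟩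
  choose β M hβ using key
  -- There are finitely many residues, so the bounds can be made uniform.
  obtain ⟨b, hb⟩ := ((Set.finite_Iio c).image β).bddBelow
  obtain ⟨K, hK⟩ := ((Set.finite_Iio c).image M).bddAbove
  refine ⟨b, K, fun n hn m hmn hne => ?_⟩
  have hr : n % c ∈ Set.Iio c := Nat.mod_lt _ hc
  have hnr : n ≡ n % c [MOD c] := (Nat.mod_modEq n c).symm
  obtain ⟨l₁, l₂, hl, u, hu, v, hv, huv⟩ := hβ (n % c) n
    ((hK (Set.mem_image_of_mem M hr)).trans hn) m hnr (hmn.trans hnr) hne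
  exact ⟨l₁, l₂, hl, u, hu, v, hv, (hb (Set.mem_image_of_mem β hr)).trans huv⟩

/-- Long paths of weight at least `β` visit a node of a zero-weight circuit. -/
theorem exists_forall_visits (hclosed : ∀ n x, ∀ c ∈ pathWeights R a n x x, c ≤ 0) {i j : S}
    {β : ℝ} (hfin : {k | ∃ m n, ∃ u ∈ pathWeights R a m i k, ∃ v ∈ pathWeights R a n k j,
      β ≤ u + v}.Finite) :
    ∃ N, ∀ n ≥ N, ∀ w ∈ pathWeights R a n i j, β ≤ w → ∃ k ∈ zeroNodes R a, ∃ l₁ l₂, l₁ + l₂ = n ∧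
      ∃ u ∈ pathWeights R a l₁ i k, ∃ v ∈ pathWeights R a l₂ k j, u + v = w := by
  set F := {k | ∃ m n, ∃ u ∈ pathWeights R a m i k, ∃ v ∈ pathWeights R a n k j, β ≤ u + v} with hF
  set G := F \ zeroNodes R a
  -- A heavy path avoiding zero-weight circuits stays in this finite subgraph, where every circuit
  -- is strictly negative.
  set R' : S → S → Prop := fun x y => R x y ∧ x ∈ G ∧ y ∈ G with hR'
  have hmono : ∀ n x y, pathWeights R' a n x y ⊆ pathWeights R a n x y := by
    rintro n x y w ⟨p, h0, hn, hp, hw⟩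
    exact ⟨p, h0, hn, fun m hm => (hp m hm).1, hw⟩
  obtain ⟨M, δ, hδ, hbound⟩ := exists_linear_bound (R := R') (a := a) (G := G)
    (hfin.subset Set.sdiff_subset) (fun x y h => h.2) (fun n x hn c hc => by
      have hx : x ∈ G := by
        obtain ⟨p, rfl, -, hp, -⟩ := hc
        exact (hp 0 hn).2.1
      refine lt_of_le_of_ne (hclosed n x c (hmono n x x hc)) ?_
      rintro rfl
      exact hx.2 ⟨n, hn, hmono n x x hc⟩) i j
  obtain ⟨N, hN⟩ := exists_nat_gt ((M - β) / δ)
  refine ⟨N, fun n hn w hw hβ => ?_⟩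
  by_contra hno
  obtain ⟨p, rfl, rfl, hp, rfl⟩ := hw
  have hsplit : ∀ m ≤ n, ∃ u ∈ pathWeights R a m (p 0) (p m),
      ∃ v ∈ pathWeights R a (n - m) (p m) (p n),
        u + v = ∑ m ∈ Finset.range n, a (p m) (p (m + 1)) := by
    intro m hm
    obtain ⟨d, rfl⟩ := Nat.exists_eq_add_of_le hm
    rw [Nat.add_sub_cancel_left]
    exact ⟨_, ⟨p, rfl, rfl, fun x hx => hp x (by omega), rfl⟩, _,
      sum_mem_pathWeights hp le_rfl,
      (Finset.sum_range_add (fun x => a (p x) (p (x + 1))) m d).symm⟩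
  have hG : ∀ m ≤ n, p m ∈ G := by
    intro m hm
    obtain ⟨u, hu, v, hv, huv⟩ := hsplit m hm
    refine ⟨⟨m, n - m, u, hu, v, hv, by rw [huv]; exact hβ⟩, fun hz => hno ?_⟩
    exact ⟨p m, hz, m, n - m, by omega, u, hu, v, hv, huv⟩
  have hle := hbound n _ ⟨p, rfl, rfl,
    fun m hm => ⟨hp m hm, hG m hm.le, hG (m + 1) hm⟩, rfl⟩
  have hNn : (N : ℝ) ≤ n := by exact_mod_cast hn
  rw [div_lt_iff₀ hδ] at hN
  nlinarith

/-- The weights of at least `β` of the paths through the nodes of zero-weight circuits are dominated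
by the weights of all sufficiently long paths with lengths in the same congruence class. -/
theorem exists_forall_dominates (hclosed : ∀ n x, ∀ c ∈ pathWeights R a n x x, c ≤ 0) {i j : S}
    {β : ℝ} {F : Set S} (hF : F.Finite)
    (hmem : ∀ k m n, ∀ u ∈ pathWeights R a m i k, ∀ v ∈ pathWeights R a n k j, β ≤ u + v → k ∈ F)
    {σ : ℕ} (hσ : 0 < σ) (hdvd : ∀ k ∈ F, k ∈ zeroNodes R a → zeroPeriod R a k ∣ σ) :
    ∃ N, ∀ n ≥ N, ∀ w ∈ zeroNodesWeights R a σ n i j, β ≤ w →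
      ∃ w' ∈ pathWeights R a n i j, w ≤ w' := by
  choose T hT using fun x => exists_zero_mem_pathWeights_of_ge R a x
  obtain ⟨K, hK⟩ := (hF.image T).bddAbove
  set f := hF.toFinset.card * σ
  -- Room for two shortened halves and for a loop beyond the threshold `T k`.
  refine ⟨f + f + K, ?_⟩
  rintro n hn _ ⟨k, hk, l₁, l₂, hl, u, hu, v, hv, rfl⟩ hβ
  have hkF := hmem k _ _ u hu v hv hβ
  obtain ⟨m₁, hm₁, hmod₁, u', hu', huu'⟩ := exists_short_path hclosed hσ hF.toFinset l₁ u hu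
    (fun x s t u₁ h₁ u₂ h₂ hle => by
      rw [hF.mem_toFinset]
      refine hmem x s _ u₁ h₁ _ (pathWeights_concat h₂ hv) (by linarith))
  obtain ⟨m₂, hm₂, hmod₂, v', hv', hvv'⟩ := exists_short_path hclosed hσ hF.toFinset l₂ v hv
    (fun x s t u₁ h₁ u₂ h₂ hle => by
      rw [hF.mem_toFinset]
      refine hmem x _ t _ (pathWeights_concat hu h₁) u₂ h₂ (by linarith))
  have hTk : T k ≤ K := hK (Set.mem_image_of_mem T hkF)
  have hd : σ ∣ n - (m₁ + m₂) :=
    (Nat.modEq_iff_dvd' (by omega)).1 ((hmod₁.add hmod₂).trans hl)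
  have h0 := hT k (n - (m₁ + m₂)) (by omega) ((hdvd k hkF hk).trans hd)
  have hw := pathWeights_concat (pathWeights_concat hu' h0) hv'
  rw [show m₁ + (n - (m₁ + m₂)) + m₂ = n by omega] at hw
  exact ⟨_, hw, by linarith⟩

/-- Ultimately, the suprema of the weights of the paths from `i` to `j` of a given length depend
only on its congruence class and are attained through nodes of zero-weight circuits. -/
theorem exists_realSup_pathWeights_eq (hclosed : ∀ n x, ∀ c ∈ pathWeights R a n x x, c ≤ 0)
    (hconn : ∀ x y, Relation.ReflTransGen R x y) (hne : (zeroNodes R a).Nonempty) (i j : S)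
    (hfin : ∀ β : ℝ, {k | ∃ m n, ∃ u ∈ pathWeights R a m i k, ∃ v ∈ pathWeights R a n k j,
      β ≤ u + v}.Finite) :
    ∃ σ N : ℕ, 0 < σ ∧ (∀ s, (∀ k ∈ zeroNodes R a, zeroPeriod R a k ∣ s) → σ ∣ s) ∧
      ∀ n ≥ N, realSup (pathWeights R a n i j) = realSup (zeroNodesWeights R a σ n i j) := by
  classical
  obtain ⟨k₀, hk₀⟩ := hne
  obtain ⟨β, N₀, hβ⟩ := exists_lower_bound hconn hk₀ i j
  obtain ⟨N₁, hN₁⟩ := exists_forall_visits hclosed (hfin β)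
  -- Only critical nodes on heavy paths enter, so the lcm is finite even if the cyclicity is not.
  -- The node `k₀` is added because paths lighter than `β` are replaced by paths through it, in the
  -- same class modulo its period.
  set E : Finset S := insert k₀ ((hfin β).toFinset.filter (· ∈ zeroNodes R a)) with hE
  have hEz : ∀ k ∈ E, k ∈ zeroNodes R a := by
    intro k hk
    rcases Finset.mem_insert.1 hk with rfl | hk
    · exact hk₀
    · exact (Finset.mem_filter.1 hk).2
  set σ := E.lcm (zeroPeriod R a) with hσdef
  have hσ : 0 < σ := by
    refine Nat.pos_of_ne_zero fun h => ?_
    obtain ⟨k, hk, h0⟩ := Finset.lcm_eq_zero_iff.1 h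
    exact (zeroPeriod_pos (hEz k hk)).ne' h0
  obtain ⟨N₂, hN₂⟩ := exists_forall_dominates hclosed (β := β) (hfin β)
    (fun k m n u hu v hv h => ⟨m, n, u, hu, v, hv, h⟩) hσ (fun k hkF hk =>
      Finset.dvd_lcm (Finset.mem_insert_of_mem
        (Finset.mem_filter.2 ⟨(hfin β).mem_toFinset.2 hkF, hk⟩)))
  refine ⟨σ, max N₀ (max N₁ N₂), hσ, fun s hs => Finset.lcm_dvd fun k hk => hs k (hEz k hk),
    fun n hn => ?_⟩
  have hn₀ : N₀ ≤ n := (le_max_left _ _).trans hn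
  have hn₁ : N₁ ≤ n := (le_max_left _ _).trans ((le_max_right _ _).trans hn)
  have hn₂ : N₂ ≤ n := (le_max_right _ _).trans ((le_max_right _ _).trans hn)
  apply le_antisymm <;> refine realSup_le_of_forall_exists fun w hw => ?_
  · rcases le_total β w with h | h
    · obtain ⟨k, hk, l₁, l₂, rfl, u, hu, v, hv, huv⟩ := hN₁ n hn₁ w hw h
      exact ⟨w, ⟨k, hk, l₁, l₂, rfl, u, hu, v, hv, huv⟩, le_rfl⟩
    · obtain ⟨l₁, l₂, rfl, u, hu, v, hv, huv⟩ := hβ n hn₀ n rfl ⟨w, hw⟩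
      exact ⟨u + v, ⟨k₀, hk₀, l₁, l₂, rfl, u, hu, v, hv, rfl⟩, h.trans huv⟩
  · rcases le_total β w with h | h
    · exact hN₂ n hn₂ w hw h
    · obtain ⟨k, -, m₁, m₂, hm, x, hx, y, hy, -⟩ := hw
      obtain ⟨l₁, l₂, rfl, u, hu, v, hv, huv⟩ := hβ n hn₀ (m₁ + m₂)
        (hm.of_dvd (Finset.dvd_lcm (Finset.mem_insert_self _ _))) ⟨_, pathWeights_concat hx hy⟩
      exact ⟨u + v, pathWeights_concat hu hv, h.trans huv⟩

end

/-! ### Kernels and weights of paths -/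

/-- The set of the weights of the paths of length `n` from `i` to `j` in the graph of `A`. -/
abbrev weights (A : S → S → EReal) (n : ℕ) (i j : S) : Set ℝ :=
  pathWeights (Arc A) (fun x y => (A x y).toReal) n i j

section

variable {A : S → S → EReal}

theorem realSup_weights_one (hA : ∀ i j, A i j ≠ ⊤) (i j : S) :
    realSup (weights A 1 i j) = A i j := by
  by_cases h : A i j = ⊥
  · have : weights A 1 i j = ∅ := by
      ext w
      simp [weights, mem_pathWeights_one, Arc, h]
    rw [this, realSup_empty, h]
  · have : weights A 1 i j = {(A i j).toReal} := by
      ext w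
      simp [weights, mem_pathWeights_one, Arc, h]
    rw [this, realSup_singleton, EReal.coe_toReal (hA i j) h]

theorem mul_eq_realSup {M M' : S → S → EReal} {X X' : S → S → Set ℝ}
    (h : ∀ i j, M i j = realSup (X i j)) (h' : ∀ i j, M' i j = realSup (X' i j)) (i j : S) :
    mul M M' i j = realSup (⋃ k, X i k + X' k j) := by
  simp only [mul, h, h', realSup_iUnion, realSup_add]

theorem one_eq_realSup (A : S → S → EReal) (i j : S) : one i j = realSup (weights A 0 i j) := by
  by_cases h : i = j
  · have : weights A 0 i j = {0} := by
      ext w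
      simp [weights, mem_pathWeights_zero, h]
    rw [this, realSup_singleton, one, if_pos h, EReal.coe_zero]
  · have : weights A 0 i j = ∅ := by
      ext w
      simp [weights, mem_pathWeights_zero, h]
    simp [this, one, h]

theorem pow_eq_realSup (hA : ∀ i j, A i j ≠ ⊤) (n : ℕ) (i j : S) :
    pow A n i j = realSup (weights A n i j) := by
  induction n generalizing i j with
  | zero => exact one_eq_realSup A i j
  | succ n ih =>
    rw [pow, mul_eq_realSup ih (fun i j => (realSup_weights_one hA i j).symm)]
    simp only [weights, pathWeights_add]

theorem pow_pow_eq_realSup (hA : ∀ i j, A i j ≠ ⊤) (σ t : ℕ) (i j : S) :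
    pow (pow A σ) t i j = realSup (weights A (σ * t) i j) := by
  induction t generalizing i j with
  | zero => exact one_eq_realSup A i j
  | succ t ih =>
    rw [pow, mul_eq_realSup ih (pow_eq_realSup hA σ), Nat.mul_succ]
    simp only [weights, pathWeights_add]

theorem mul_pow_kleeneStar_eq_realSup (hA : ∀ i j, A i j ≠ ⊤) (q σ : ℕ) (i j : S) :
    mul (pow A q) (kleeneStar (pow A σ)) i j = realSup (⋃ t : ℕ, weights A (q + σ * t) i j) := by
  have h : ∀ i j, kleeneStar (pow A σ) i j = realSup (⋃ t : ℕ, weights A (σ * t) i j) := by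
    intro i j
    simp only [kleeneStar, pow_pow_eq_realSup hA, realSup_iUnion]
  rw [mul_eq_realSup (pow_eq_realSup hA q) h]
  simp only [weights, pathWeights_add, Set.add_iUnion]
  rw [Set.iUnion_comm]

theorem le_kleeneStar (hA : ∀ i j, A i j ≠ ⊤) {n : ℕ} {i j : S} {w : ℝ}
    (hw : w ∈ weights A n i j) : (w : EReal) ≤ kleeneStar A i j := by
  refine le_iSup_of_le n ?_
  rw [pow_eq_realSup hA]
  exact le_realSup hw

theorem weight_eq_coe (hA : ∀ i j, A i j ≠ ⊤) {n : ℕ} {p : ℕ → S} (hp : IsPath (Arc A) n p) :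
    weight A n p = ((∑ m ∈ Finset.range n, (A (p m) (p (m + 1))).toReal : ℝ) : EReal) := by
  induction n with
  | zero => simp [weight]
  | succ n ih =>
    have := ih fun m hm => hp m (by omega)
    rw [weight] at this ⊢
    rw [Finset.sum_range_succ, Finset.sum_range_succ, this, EReal.coe_add,
      EReal.coe_toReal (hA _ _) (hp n (by omega))]

end

/-! ### The normalized kernel -/

section

variable {A : S → S → EReal} {r : ℝ}

theorem normalized_ne_top (hA : ∀ i j, A i j ≠ ⊤) (hr : rho A = (r : EReal)) (i j : S) :
    normalized A i j ≠ ⊤ := by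
  rw [normalized, hr, sub_eq_add_neg, ← EReal.coe_neg]
  exact EReal.add_ne_top (hA i j) (EReal.coe_ne_top _)

theorem arc_normalized (hr : rho A = (r : EReal)) : Arc (normalized A) = Arc A := by
  ext i j
  rw [Arc, Arc, normalized, hr, sub_eq_add_neg, ← EReal.coe_neg, Ne, EReal.add_eq_bot_iff]
  simp

theorem sum_toReal_normalized (hA : ∀ i j, A i j ≠ ⊤) (hr : rho A = (r : EReal)) {n : ℕ}
    {p : ℕ → S} (hp : IsPath (Arc A) n p) :
    ∑ m ∈ Finset.range n, (normalized A (p m) (p (m + 1))).toReal =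
      ∑ m ∈ Finset.range n, (A (p m) (p (m + 1))).toReal - n * r := by
  have : ∀ m ∈ Finset.range n, (normalized A (p m) (p (m + 1))).toReal =
      (A (p m) (p (m + 1))).toReal - r := by
    intro m hm
    rw [normalized, hr, EReal.toReal_sub (hA _ _) (hp m (Finset.mem_range.1 hm))
      (EReal.coe_ne_top _) (EReal.coe_ne_bot _), EReal.toReal_coe]
  rw [Finset.sum_congr rfl this]
  simp

theorem weights_eq_add (hA : ∀ i j, A i j ≠ ⊤) (hr : rho A = (r : EReal)) (n : ℕ) (i j : S) :
    weights A n i j = {(n * r : ℝ)} + weights (normalized A) n i j := by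
  ext w
  simp only [Set.singleton_add, Set.mem_image]
  constructor
  · rintro ⟨p, h0, hn, hp, rfl⟩
    refine ⟨_, ⟨p, h0, hn, by rwa [arc_normalized hr], rfl⟩, ?_⟩
    rw [sum_toReal_normalized hA hr hp]
    ring
  · rintro ⟨_, ⟨p, h0, hn, hp, rfl⟩, rfl⟩
    rw [arc_normalized hr] at hp
    refine ⟨p, h0, hn, hp, ?_⟩
    rw [sum_toReal_normalized hA hr hp]
    ring

theorem pow_eq_add (hA : ∀ i j, A i j ≠ ⊤) (hr : rho A = (r : EReal)) (n : ℕ) (i j : S) :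
    pow A n i j = ((n * r : ℝ) : EReal) + pow (normalized A) n i j := by
  rw [pow_eq_realSup hA, pow_eq_realSup (normalized_ne_top hA hr), weights_eq_add hA hr,
    realSup_add, realSup_singleton]

/-- Restoring `r` on each arc gives a closed path of `A`, whose mean is at most `ρ(A) = r` by
definition of the supremum. -/
theorem closed_weights_nonpos (hA : ∀ i j, A i j ≠ ⊤) (hr : rho A = (r : EReal)) (n : ℕ) (x : S)
    (c : ℝ) (hc : c ∈ weights (normalized A) n x x) : c ≤ 0 := by
  cases n with
  | zero => exact (mem_pathWeights_zero.1 hc).2.le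
  | succ n =>
    have hmem : ((n + 1 : ℕ) : ℝ) * r + c ∈ weights A (n + 1) x x := by
      rw [weights_eq_add hA hr]
      exact Set.add_mem_add rfl hc
    have h1 : ((((n + 1 : ℕ) : ℝ) * r + c : ℝ) : EReal) ≤ trace (pow A (n + 1)) := by
      refine (le_realSup hmem).trans ?_
      rw [← pow_eq_realSup hA]
      exact le_iSup (fun i => pow A (n + 1) i i) x
    have h2 : trace (pow A (n + 1)) / ((n + 1 : ℕ) : EReal) ≤ (r : EReal) := by
      rw [← hr]
      exact le_iSup (fun k : ℕ => trace (pow A (k + 1)) / ((k + 1 : ℕ) : EReal)) n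
    rw [EReal.div_le_iff_le_mul (by exact_mod_cast n.succ_pos) (EReal.natCast_ne_top _)] at h2
    have h3 := h1.trans h2
    rw [← EReal.coe_coe_eq_natCast, ← EReal.coe_mul, EReal.coe_le_coe_iff] at h3
    linarith

/-! ### Critical graph and zero-weight circuits -/

theorem isCriticalCircuit_iff (hA : ∀ i j, A i j ≠ ⊤) (hr : rho A = (r : EReal)) {n : ℕ}
    {p : ℕ → S} : IsCriticalCircuit A n p ↔ IsCircuit (Arc A) n p ∧
      ∑ m ∈ Finset.range n, (normalized A (p m) (p (m + 1))).toReal = 0 := by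
  refine and_congr_right fun ⟨hn, hp, _⟩ => ?_
  have hn' : (n : ℝ) ≠ 0 := by exact_mod_cast hn.ne'
  rw [weight_eq_coe hA hp, hr, sum_toReal_normalized hA hr hp, ← EReal.coe_coe_eq_natCast,
    ← EReal.coe_div, EReal.coe_eq_coe_iff, div_eq_iff hn', sub_eq_zero, mul_comm r]

/-- The rest of a critical circuit through the arc leads back, with the opposite weight since the
total is zero. -/
theorem exists_return_of_criticalArc (hA : ∀ i j, A i j ≠ ⊤) (hr : rho A = (r : EReal)) {x y : S}
    (h : CriticalArc A x y) : ∃ d, ∃ w ∈ weights (normalized A) 1 x y,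
      -w ∈ weights (normalized A) d y x := by
  obtain ⟨n, p, hc, m, hm, rfl, rfl⟩ := h
  obtain ⟨⟨hn, hp, hcl⟩, hsum⟩ := (isCriticalCircuit_iff hA hr).1 hc
  rw [← arc_normalized hr] at hp
  obtain ⟨d, rfl⟩ := Nat.exists_eq_add_of_le (show m + 1 ≤ n from hm)
  set b : S → S → ℝ := fun x y => (normalized A x y).toReal
  have h1 : ∑ k ∈ Finset.range 1, b (p (m + k)) (p (m + k + 1)) ∈
      weights (normalized A) 1 (p m) (p (m + 1)) := sum_mem_pathWeights hp (by omega)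
  have h2 : ∑ k ∈ Finset.range d, b (p (m + 1 + k)) (p (m + 1 + k + 1)) ∈
      weights (normalized A) d (p (m + 1)) (p (m + 1 + d)) := sum_mem_pathWeights hp le_rfl
  have h3 : ∑ k ∈ Finset.range m, b (p k) (p (k + 1)) ∈
      weights (normalized A) m (p 0) (p m) := ⟨p, rfl, rfl, fun k hk => hp k (by omega), rfl⟩
  rw [hcl] at h2
  refine ⟨d + m, _, h1, ?_⟩
  have h4 := pathWeights_concat h2 h3
  change ∑ k ∈ Finset.range (m + 1 + d), b (p k) (p (k + 1)) = 0 at hsum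
  rw [Finset.sum_range_add, Finset.sum_range_add (fun k => b (p k) (p (k + 1)))] at hsum
  convert h4 using 1
  linarith

theorem zeroNodes_normalized (hA : ∀ i j, A i j ≠ ⊤) (hr : rho A = (r : EReal)) :
    zeroNodes (Arc (normalized A)) (fun x y => (normalized A x y).toReal) = criticalNodes A := by
  ext x
  constructor
  · rintro ⟨n, hn, p, rfl, hpn, hp, hsum⟩
    rw [arc_normalized hr] at hp
    exact ⟨n, p, (isCriticalCircuit_iff hA hr).2 ⟨⟨hn, hp, hpn⟩, hsum⟩, 0, hn, rfl⟩
  · rintro ⟨n, p, hc, m, hm, rfl⟩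
    obtain ⟨d, w, h1, h2⟩ := exists_return_of_criticalArc hA hr ⟨n, p, hc, m, hm, rfl, rfl⟩
    refine ⟨1 + d, by omega, ?_⟩
    simpa using pathWeights_concat h1 h2

theorem exists_return_of_reflTransGen (hA : ∀ i j, A i j ≠ ⊤) (hr : rho A = (r : EReal)) {x y : S}
    (h : Relation.ReflTransGen (CriticalArc A) x y) :
    ∃ m n, ∃ w ∈ weights (normalized A) m x y, -w ∈ weights (normalized A) n y x := by
  induction h with
  | refl =>
    exact ⟨0, 0, 0, pathWeights_zero_self x, by simpa using pathWeights_zero_self x⟩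
  | tail _ harc ih =>
    obtain ⟨m, n, w, h1, h2⟩ := ih
    obtain ⟨d, v, h3, h4⟩ := exists_return_of_criticalArc hA hr harc
    refine ⟨m + 1, d + n, w + v, pathWeights_concat h1 h3, ?_⟩
    rw [show -(w + v) = -v + -w by ring]
    exact pathWeights_concat h4 h2

/-- Unlike for `exists_return_of_reflTransGen`, the length `n` is kept, as the divisibility of
periods needs it. -/
theorem exists_return_of_isPath (hA : ∀ i j, A i j ≠ ⊤) (hr : rho A = (r : EReal)) {n : ℕ}
    {p : ℕ → S} (hp : IsPath (CriticalArc A) n p) :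
    ∃ d, ∃ w ∈ weights (normalized A) n (p 0) (p n),
      -w ∈ weights (normalized A) d (p n) (p 0) := by
  induction n with
  | zero => exact ⟨0, 0, pathWeights_zero_self _, by simpa using pathWeights_zero_self _⟩
  | succ n ih =>
    obtain ⟨d, w, h1, h2⟩ := ih fun m hm => hp m (by omega)
    obtain ⟨d', v, h3, h4⟩ := exists_return_of_criticalArc hA hr (hp n (by omega))
    refine ⟨d' + d, w + v, pathWeights_concat h1 h3, ?_⟩
    rw [show -(w + v) = -v + -w by ring]
    exact pathWeights_concat h4 h2

/-- A circuit of critical arcs and its return path are both closed with opposite weights, both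
nonpositive, so the circuit has weight zero. Joining it to `k` by a path and a return of opposite
weights makes `s + t` and `s + n + t` zero-weight loop lengths at `k`; the period divides their
difference `n`. -/
theorem zeroPeriod_dvd_componentCyclicity (hA : ∀ i j, A i j ≠ ⊤) (hr : rho A = (r : EReal))
    (k : S) : zeroPeriod (Arc (normalized A)) (fun x y => (normalized A x y).toReal) k ∣
      componentCyclicity (CriticalArc A) k := by
  refine Nat.dvd_setGcd_iff.2 ?_
  rintro n ⟨p, ⟨-, hp, hcl⟩, hcomp⟩
  obtain ⟨s, t, w, h1, h2⟩ := exists_return_of_reflTransGen hA hr (hcomp 0 n.zero_le).1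
  obtain ⟨d, v, h3, h4⟩ := exists_return_of_isPath hA hr hp
  rw [hcl] at h3 h4
  have hv : v = 0 := by
    have := closed_weights_nonpos hA hr _ _ _ h3
    have := closed_weights_nonpos hA hr _ _ _ h4
    linarith
  subst hv
  have hst : (0 : ℝ) ∈ weights (normalized A) (s + t) k k := by
    simpa using pathWeights_concat h1 h2
  have hsnt : (0 : ℝ) ∈ weights (normalized A) (s + n + t) k k := by
    simpa using pathWeights_concat (pathWeights_concat h1 h3) h2
  refine (Nat.dvd_add_right (Nat.setGcd_dvd_of_mem hst)).1 ?_
  rw [show s + t + n = s + n + t by ring]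
  exact Nat.setGcd_dvd_of_mem hsnt

/-- A finite infimum in `ℕ∞` is attained, as the empty infimum is `⊤`. -/
theorem componentCyclicity_dvd_of_cyclicity_eq {N : Set S} {R : S → S → Prop} {s : ℕ}
    (h : cyclicity N R = (s : ℕ∞)) {k : S} (hk : k ∈ N) : componentCyclicity R k ∣ s := by
  rw [cyclicity, iInf_subtype'] at h
  rcases isEmpty_or_nonempty {m : ℕ | 0 < m ∧ ∀ v ∈ N, componentCyclicity R v ∣ m} with he | he
  · rw [iInf_of_empty] at h
    exact (ENat.natCast_ne_top s h.symm).elim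
  · obtain ⟨⟨m, hm⟩, hms⟩ := ciInf_mem
      (fun x : {m : ℕ | 0 < m ∧ ∀ v ∈ N, componentCyclicity R v ∣ m} => ((x : ℕ) : ℕ∞))
    have : m = s := Nat.cast_injective (R := ℕ∞) (hms.trans h)
    exact this ▸ hm.2 k hk

end

end MaxPlus

/-! ### The cyclicity theorem -/

theorem mainTheorem1 {S : Type*} (A : S → S → EReal)
    (hA : ∀ i j, A i j ≠ ⊤)
    (hρ : ∃ r : ℝ, MaxPlus.rho A = (r : EReal))
    (hirr : MaxPlus.IsIrreducible A)
    (hT : MaxPlus.PropertyT (MaxPlus.normalized A))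
    (hcrit : (MaxPlus.criticalNodes A).Nonempty)
    (i j : S) :
    ∃ σ N : ℕ, 0 < σ ∧
      (∀ n ≥ N, MaxPlus.pow A (n + σ) i j = σ • MaxPlus.rho A + MaxPlus.pow A n i j) ∧
      (∀ n ≥ N, ∀ q < σ, ∀ q' < σ, q + q' ≡ n [MOD σ] →
        MaxPlus.pow (MaxPlus.normalized A) n i j =
          ⨆ k ∈ MaxPlus.criticalNodes A,
            MaxPlus.mul (MaxPlus.pow (MaxPlus.normalized A) q)
                (MaxPlus.kleeneStar (MaxPlus.pow (MaxPlus.normalized A) σ)) i k +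
              MaxPlus.mul (MaxPlus.pow (MaxPlus.normalized A) q')
                (MaxPlus.kleeneStar (MaxPlus.pow (MaxPlus.normalized A) σ)) k j) ∧
      (∀ s : ℕ, MaxPlus.criticalCyclicity A = (s : ℕ∞) → σ ∣ s) := by
  open MaxPlus in
  obtain ⟨r, hr⟩ := hρ
  have hB := normalized_ne_top hA hr
  have hfin : ∀ β : ℝ, {k | ∃ m n, ∃ u ∈ weights (normalized A) m i k,
      ∃ v ∈ weights (normalized A) n k j, β ≤ u + v}.Finite := by
    intro β
    -- Path weights lie below the entries of the Kleene star, so Property (T) bounds the set of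
    -- nodes on heavy paths.
    refine ((hT j i).2 β).subset ?_
    rintro k ⟨m, n, u, hu, v, hv, h⟩
    calc (β : EReal) ≤ ((u + v : ℝ) : EReal) := EReal.coe_le_coe_iff.2 h
      _ = (u : EReal) + v := EReal.coe_add u v
      _ ≤ _ := add_le_add (le_kleeneStar hB hu) (le_kleeneStar hB hv)
  obtain ⟨σ, N, hσ, hdvd, heq⟩ := exists_realSup_pathWeights_eq
    (closed_weights_nonpos hA hr) (by rw [arc_normalized hr]; exact fun x y => (hirr.2 x y).1)
    (by rwa [zeroNodes_normalized hA hr]) i j hfin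
  have hpow : ∀ n ≥ N, pow (normalized A) n i j = realSup (zeroNodesWeights (Arc (normalized A))
      (fun x y => (normalized A x y).toReal) σ n i j) := fun n hn =>
    (pow_eq_realSup hB n i j).trans (heq n hn)
  refine ⟨σ, N, hσ, fun n hn => ?_, fun n hn q hq q' hq' hmod => ?_, fun s hs => ?_⟩
  · have hper : pow (normalized A) (n + σ) i j = pow (normalized A) n i j := by
      rw [hpow n hn, hpow (n + σ) (by omega)]
      -- The length `n` enters `zeroNodesWeights` only through its residue modulo `σ`.
      simp only [zeroNodesWeights, Nat.ModEq, Nat.add_mod_right]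
    rw [pow_eq_add hA hr, pow_eq_add hA hr n, hper, hr, ← EReal.coe_nsmul, ← add_assoc,
      ← EReal.coe_add, nsmul_eq_mul]
    congr 2
    push_cast
    ring
  · rw [hpow n hn, zeroNodesWeights_eq hσ hq' hmod, zeroNodes_normalized hA hr]
    simp only [realSup_iUnion, realSup_add, mul_pow_kleeneStar_eq_realSup hB]
  · refine hdvd s fun k hk => ?_
    rw [zeroNodes_normalized hA hr] at hk
    exact (zeroPeriod_dvd_componentCyclicity hA hr k).trans
      (componentCyclicity_dvd_of_cyclicity_eq hs hk)
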